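/- Let $X$ be a perfect compact metric space (a compact metric space without isolated points) with its Borel $\sigma$-algebra, let $f:X\to X$ be a Borel measurable map and let $\mu$ be a finite $f$-invariant Borel measure on $X$. For $x\in X$ and $A\subset X$ put $$\tau_x(A)=\limsup_{n\to\infty}\frac1n\sum_{j=0}^{n-1}\delta_{f^j(x)}(A),$$ and let $\eta_x$ be the Borel measure obtained from $\tau_x$ by Carathéodory's Method II on the open sets, that is, for every Borel set $Y\subset X$, $$\eta_x(Y)=\sup_{r>0}\ \inf\Big\{\sum_{i}\tau_x(I_i)\ :\ (I_i)_i\text{ a countable cover of }Y\text{ by open sets with }\operatorname{diam}(I_i)\le r\text{ for all }i\Big\}.$$ Then for $\mu$-almost every $x\in X$ the measure $\eta_x$ is an $f$-invariant ergodic probability measure. Furthermore $\mu=\int_X\eta_x\,d\mu(x)$. That is, for every $\varphi\in L^1(\mu)$ the function $\varphi$ is $\eta_x$-integrable for $\mu$-almost every $x$, the function $x\mapsto\int\varphi\,d\eta_x$ is $\mu$-integrable, and $$\int\varphi\,d\mu=\int_X\Big(\int\varphi\,d\eta_x\Big)\,d\mu(x);$$ in particular, for every Borel set $V\subset X$ the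 function $x\mapsto\eta_x(V)$ is $\mu$-measurable and $\mu(V)=\int_X\eta_x(V)\,d\mu(x)$. -/

import Mathlib

open MeasureTheory Filter
open scoped ENNReal

noncomputable section

namespace OrbitMeasure

/-- The unit point mass at `y`, evaluated on an arbitrary (not necessarily measurable) subset. -/
def pointMass {X : Type*} (y : X) (A : Set X) : ℝ≥0∞ :=
  A.indicator (fun _ => 1) y

/-- The upper average `τ(A) = limsup (1/n) ∑_{j<n} ξ_j(A)` of a sequence of set functions. -/
def upperAverage {X : Type*} (ξ : ℕ → Set X → ℝ≥0∞) (A : Set X) : ℝ≥0∞ :=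
  limsup (fun n : ℕ => (n : ℝ≥0∞)⁻¹ * ∑ j ∈ Finset.range n, ξ j A) atTop

/-- The premeasure `τ_x` of the forward orbit of `x`: the upper asymptotic frequency of visits
of `x, f x, f² x, …` to a set. -/
def orbitPremeasure {X : Type*} (f : X → X) (x : X) : Set X → ℝ≥0∞ :=
  upperAverage fun j => pointMass (f^[j] x)

/-- The restriction to the Borel sets of the Carathéodory (Method II) measure constructed from a
premeasure `τ` on the open sets. Giving value `∞` to the other sets leaves only covers by open
sets in the infimum; see `methodII_apply` for the explicit formula. -/
def methodII {X : Type*} [MetricSpace X] [MeasurableSpace X] [BorelSpace X]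
    (τ : Set X → ℝ≥0∞) : Measure X :=
  Measure.mkMetric' fun U => ⨅ _ : IsOpen U, τ U

/-- `sup_{r>0} inf ∑ τ(I_i)`, over countable covers of `Y` by open sets of diameter at most `r`
(finite covers are completed with empty sets). -/
theorem methodII_apply {X : Type*} [MetricSpace X] [MeasurableSpace X] [BorelSpace X]
    (τ : Set X → ℝ≥0∞) (hτ : τ ∅ = 0) {Y : Set X} (hY : MeasurableSet Y) :
    methodII τ Y =
      ⨆ (r : ℝ≥0∞) (_ : 0 < r),
        ⨅ (I : ℕ → Set X) (_ : ∀ i, IsOpen (I i) ∧ Metric.ediam (I i) ≤ r) (_ : Y ⊆ ⋃ i, I i),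
          ∑' i, τ (I i) := by
  rw [methodII, Measure.mkMetric', toMeasure_apply _ _ hY, OuterMeasure.mkMetric']
  simp only [OuterMeasure.iSup_apply]
  refine iSup_congr fun r => iSup_congr fun _ => ?_
  have h0 : (extend fun (s : Set X) (_ : Metric.ediam s ≤ r) => ⨅ _ : IsOpen s, τ s) ∅ = 0 := by
    simp [extend, hτ]
  rw [OuterMeasure.mkMetric'.pre, OuterMeasure.boundedBy_eq_ofFunction h0,
    OuterMeasure.ofFunction_apply]
  refine iInf_congr fun I => ?_
  by_cases hI : ∀ i, IsOpen (I i) ∧ Metric.ediam (I i) ≤ r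
  · simp [extend, hI]
  · rw [iInf_neg hI]
    push Not at hI
    obtain ⟨i, hi⟩ := hI
    refine iInf_eq_top.2 fun _ => ENNReal.tsum_eq_top_of_eq_top ⟨i, ?_⟩
    simp only [extend, iInf_eq_top]
    intro h1 h2
    exact absurd h1 (not_le.2 (hi h2))

/-- The measure `η_x` associated with the forward orbit of `x` under `f`. -/
def orbitMeasure {X : Type*} [MetricSpace X] [MeasurableSpace X] [BorelSpace X]
    (f : X → X) (x : X) : Measure X :=
  methodII (orbitPremeasure f x)

end OrbitMeasure

end

/-! Disintegrate `μ` over the σ-algebra of invariant sets into conditional probabilities `κ x`. By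
Birkhoff's theorem, applied to a countable dense set of continuous functions, the empirical measures
of almost every orbit converge weakly to `κ x`. The portmanteau theorem then gives `κ x U ≤ τ_x U ≤
κ x (closure U)` for open `U`. The left inequality yields `κ x ≤ η_x`; the right one, tested on
economical fine covers, bounds the mass of `η_x` by 1. Hence `η_x = κ x` almost everywhere
(`orbitMeasure_eq_of_tendsto_birkhoffAverage`).

It remains to study `κ x`. It is invariant because the averages of `g` and `g ∘ f` have the same
limit. It is ergodic because `κ x`-almost every `y` equidistributes towards `κ y`, which has the
same integrals as `κ x`. The integral formulas are those of conditional expectation. -/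

open scoped Topology

/-! ### Maximal inequality and Birkhoff's pointwise ergodic theorem. -/

section Birkhoff

variable {α : Type*} [MeasurableSpace α] {f : α → α} {μ : Measure α}

/-- The maximum of the first Birkhoff sums (including the empty one) of `h`. -/
noncomputable def birkhoffMax (f : α → α) (h : α → ℝ) : ℕ → α → ℝ
  | 0 => 0
  | n + 1 => fun x => max 0 (h x + birkhoffMax f h n (f x))

omit [MeasurableSpace α] in
theorem birkhoffMax_nonneg (h : α → ℝ) (n : ℕ) (x : α) : 0 ≤ birkhoffMax f h n x := by
  cases n with
  | zero => exact le_rfl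
  | succ n => exact le_max_left _ _

omit [MeasurableSpace α] in
theorem birkhoffMax_le_succ (h : α → ℝ) (n : ℕ) (x : α) :
    birkhoffMax f h n x ≤ birkhoffMax f h (n + 1) x := by
  induction n generalizing x with
  | zero => exact birkhoffMax_nonneg h 1 x
  | succ n ih => exact max_le_max le_rfl (by linarith [ih (f x)])

omit [MeasurableSpace α] in
theorem birkhoffSum_le_birkhoffMax (h : α → ℝ) (n : ℕ) (x : α) :
    birkhoffSum f h n x ≤ birkhoffMax f h n x := by
  induction n generalizing x with
  | zero => simp [birkhoffMax]
  | succ n ih =>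
    rw [birkhoffSum_succ']
    exact le_max_of_le_right (by linarith [ih (f x)])

-- A positive maximum is attained by the second branch of the recursion, and raising the index on
-- the right only increases it. This is Garsia's inequality behind the maximal ergodic theorem.
omit [MeasurableSpace α] in
theorem birkhoffMax_le_add {h : α → ℝ} {n : ℕ} {x : α} (hx : 0 < birkhoffMax f h n x) :
    birkhoffMax f h n x ≤ h x + birkhoffMax f h n (f x) := by
  cases n with
  | zero => exact absurd hx (lt_irrefl _)
  | succ n =>
    have h1 : birkhoffMax f h (n + 1) x = max 0 (h x + birkhoffMax f h n (f x)) := rfl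
    rcases max_choice 0 (h x + birkhoffMax f h n (f x)) with h2 | h2
    · rw [h1, h2] at hx
      exact absurd hx (lt_irrefl _)
    · rw [h1, h2]
      linarith [birkhoffMax_le_succ (f := f) h n (f x)]

theorem measurable_birkhoffMax (hf : Measurable f) {h : α → ℝ} (hh : Measurable h) (n : ℕ) :
    Measurable (birkhoffMax f h n) := by
  induction n with
  | zero => exact measurable_const
  | succ n ih => exact measurable_const.max (hh.add (ih.comp hf))

theorem integrable_birkhoffMax (hf : MeasurePreserving f μ μ) {h : α → ℝ} (hh : Integrable h μ)
    (n : ℕ) : Integrable (birkhoffMax f h n) μ := by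
  induction n with
  | zero => exact integrable_zero _ _ _
  | succ n ih => exact (integrable_zero α ℝ μ).sup (hh.add (hf.integrable_comp_of_integrable ih))

/-- The maximal ergodic theorem. -/
theorem setIntegral_birkhoffMax_pos_nonneg (hf : MeasurePreserving f μ μ) {h : α → ℝ}
    (hm : Measurable h) (hh : Integrable h μ) (n : ℕ) :
    0 ≤ ∫ x in {x | 0 < birkhoffMax f h n x}, h x ∂μ := by
  set M := birkhoffMax f h n
  have hM : Integrable M μ := integrable_birkhoffMax hf hh n
  have hMf : Integrable (fun x => M (f x)) μ := hf.integrable_comp_of_integrable hM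
  have hs : MeasurableSet {x | 0 < M x} :=
    measurableSet_lt measurable_const (measurable_birkhoffMax hf.measurable hm n)
  have h0 : ∫ x, (M x - M (f x)) ∂μ = 0 := by
    rw [integral_sub hM hMf, sub_eq_zero]
    conv_lhs => rw [← hf.map_eq]
    exact integral_map hf.aemeasurable (by rw [hf.map_eq]; exact hM.1)
  rw [← integral_indicator hs]
  -- Pointwise, `M - M ∘ f` is at most `h` where `M > 0`, and at most `0` where `M = 0`.
  refine h0.ge.trans (integral_mono (hM.sub hMf) (hh.indicator hs) fun x => ?_)
  by_cases hx : 0 < M x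
  · rw [Set.indicator_of_mem (by exact hx)]
    have := birkhoffMax_le_add hx
    simp only [M] at *
    linarith
  · rw [Set.indicator_of_notMem (by exact hx)]
    have := birkhoffMax_nonneg (f := f) h n (f x)
    simp only [M] at *
    linarith

theorem integral_nonneg_of_exists_birkhoffSum_pos (hf : MeasurePreserving f μ μ) {h : α → ℝ}
    (hm : Measurable h) (hh : Integrable h μ) (hpos : ∀ᵐ x ∂μ, ∃ n, 0 < birkhoffSum f h n x) :
    0 ≤ ∫ x, h x ∂μ := by
  have hU : (⋃ n, {x | 0 < birkhoffMax f h n x}) =ᵐ[μ] Set.univ := by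
    rw [eventuallyEq_univ]
    filter_upwards [hpos] with x ⟨n, hn⟩
    exact Set.mem_iUnion.2 ⟨n, hn.trans_le (birkhoffSum_le_birkhoffMax h n x)⟩
  rw [← setIntegral_univ, ← setIntegral_congr_set hU]
  refine ge_of_tendsto' (tendsto_setIntegral_of_monotone (fun n => ?_) ?_ hh.integrableOn)
    (setIntegral_birkhoffMax_pos_nonneg hf hm hh)
  · exact measurableSet_lt measurable_const (measurable_birkhoffMax hf.measurable hm n)
  · exact monotone_nat_of_le_succ fun n x hx => lt_of_lt_of_le hx (birkhoffMax_le_succ h n x)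

theorem measurable_birkhoffSum (hf : Measurable f) {h : α → ℝ} (hh : Measurable h) (n : ℕ) :
    Measurable (birkhoffSum f h n) :=
  Finset.measurable_fun_sum _ fun i _ => hh.comp (hf.iterate i)

-- Makes the set of unbounded sums strictly invariant. Levels are naturals so that countably many
-- suffice and the empty sum never exceeds one.
omit [MeasurableSpace α] in
theorem birkhoffSum_unbounded_iff (h : α → ℝ) (x : α) :
    (∀ N : ℕ, ∃ n, (N : ℝ) < birkhoffSum f h n (f x)) ↔
      ∀ N : ℕ, ∃ n, (N : ℝ) < birkhoffSum f h n x := by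
  constructor
  · intro H N
    obtain ⟨K, hK⟩ := exists_nat_gt ((N : ℝ) - h x)
    obtain ⟨n, hn⟩ := H K
    exact ⟨n + 1, by rw [birkhoffSum_succ']; linarith⟩
  · intro H N
    obtain ⟨K, hK⟩ := exists_nat_gt ((N : ℝ) + h x)
    obtain ⟨n, hn⟩ := H (max K 0)
    cases n with
    | zero =>
      rw [birkhoffSum_zero] at hn
      exact absurd hn (not_lt.2 (Nat.cast_nonneg _))
    | succ n =>
      rw [birkhoffSum_succ'] at hn
      refine ⟨n, ?_⟩
      have : (K : ℝ) ≤ (max K 0 : ℕ) := by exact_mod_cast le_max_left _ _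
      linarith

/-- If the integral of `g` is at most that of `c` over every invariant set, then for `ε > 0`
the Birkhoff sums of `g - c - ε` are almost everywhere bounded above. -/
theorem ae_bddAbove_birkhoffSum [IsFiniteMeasure μ] (hf : MeasurePreserving f μ μ) {g c : α → ℝ}
    (hgm : Measurable g) (hg : Integrable g μ) (hcm : Measurable c) (hc : Integrable c μ)
    (hgc : ∀ s, MeasurableSet s → f ⁻¹' s = s → ∫ x in s, g x ∂μ ≤ ∫ x in s, c x ∂μ)
    {ε : ℝ} (hε : 0 < ε) :
    ∀ᵐ x ∂μ, ∃ N : ℕ, ∀ n, birkhoffSum f (fun y => g y - c y - ε) n x ≤ N := by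
  set h : α → ℝ := fun y => g y - c y - ε
  set D : Set α := {x | ∀ N : ℕ, ∃ n, (N : ℝ) < birkhoffSum f h n x}
  have hm : Measurable h := (hgm.sub hcm).sub_const ε
  have hi : Integrable h μ := (hg.sub hc).sub (integrable_const ε)
  have hD : MeasurableSet D := by
    have : D = ⋂ N : ℕ, ⋃ n, {x | (N : ℝ) < birkhoffSum f h n x} := by
      ext x
      simp [D]
    rw [this]
    exact .iInter fun N => .iUnion fun n =>
      measurableSet_lt measurable_const (measurable_birkhoffSum hf.measurable hm n)
  have hfD : f ⁻¹' D = D := Set.ext fun x => birkhoffSum_unbounded_iff h x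
  have hres : MeasurePreserving f (μ.restrict D) (μ.restrict D) := by
    have := hf.restrict_preimage hD
    rwa [hfD] at this
  -- The maximal inequality on the invariant set `D` gives `0 ≤ ∫_D (g - c) - ε μ(D) ≤ -ε μ(D)`, so
  -- `D` is null.
  have h0 : 0 ≤ ∫ x in D, h x ∂μ := by
    refine integral_nonneg_of_exists_birkhoffSum_pos hres hm hi.integrableOn ?_
    filter_upwards [ae_restrict_mem hD] with x hx
    simpa using! hx 0
  have h1 : ∫ x in D, h x ∂μ = ∫ x in D, g x ∂μ - ∫ x in D, c x ∂μ - ε * μ.real D := by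
    simp only [h]
    rw [integral_sub (f := fun y => g y - c y) (hg.sub hc).integrableOn (integrable_const ε),
      integral_sub hg.integrableOn hc.integrableOn, setIntegral_const, smul_eq_mul, mul_comm]
  have h2 : μ.real D ≤ 0 := by
    have := hgc D hD hfD
    by_contra! hlt
    have := mul_pos hε hlt
    linarith
  have h3 : μ D = 0 := by
    rw [← measureReal_eq_zero_iff]
    exact le_antisymm h2 measureReal_nonneg
  filter_upwards [measure_eq_zero_iff_ae_notMem.1 h3] with x hx
  simpa [D] using hx

omit [MeasurableSpace α] in
theorem birkhoffSum_sub_invariant_sub_const {c : α → ℝ} (hc : c ∘ f = c) (g : α → ℝ) (ε : ℝ)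
    (n : ℕ) (x : α) :
    birkhoffSum f (fun y => g y - c y - ε) n x = birkhoffSum f g n x - n * (c x + ε) := by
  have hit : ∀ k, c (f^[k] x) = c x := fun k => by
    induction k with
    | zero => rfl
    | succ k ih => rw [Function.iterate_succ_apply', ← ih]; exact congrFun hc _
  simp only [birkhoffSum, hit, Finset.sum_sub_distrib, Finset.sum_const, Finset.card_range,
    nsmul_eq_mul]
  ring

omit [MeasurableSpace α] in
theorem eventually_birkhoffAverage_lt {c : α → ℝ} (hc : c ∘ f = c) {g : α → ℝ} {ε : ℝ}
    (hε : 0 < ε) {x : α} {N : ℕ}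
    (hN : ∀ n, birkhoffSum f (fun y => g y - c y - ε) n x ≤ N) :
    ∀ᶠ n in atTop, birkhoffAverage ℝ f g n x < c x + 2 * ε := by
  have ht : Tendsto (fun n : ℕ => (N : ℝ) / n) atTop (𝓝 0) :=
    tendsto_const_div_atTop_nhds_zero_nat _
  filter_upwards [ht.eventually_lt_const hε, eventually_gt_atTop 0] with n hn hn0
  have hn0 : (0 : ℝ) < n := by exact_mod_cast hn0
  have h1 := hN n
  rw [birkhoffSum_sub_invariant_sub_const hc] at h1
  rw [birkhoffAverage, smul_eq_mul, inv_mul_eq_div, div_lt_iff₀ hn0]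
  rw [div_lt_iff₀ hn0] at hn
  nlinarith

/-- **Birkhoff's pointwise ergodic theorem**: for a finite invariant measure, the Birkhoff averages
of an integrable function converge almost everywhere to its conditional expectation with respect to
the σ-algebra of invariant sets. -/
theorem ae_tendsto_birkhoffAverage_condExp [IsFiniteMeasure μ] (hf : MeasurePreserving f μ μ)
    {g : α → ℝ} (hgm : Measurable g) (hg : Integrable g μ) :
    ∀ᵐ x ∂μ, Tendsto (fun n => birkhoffAverage ℝ f g n x) atTop
      (𝓝 ((μ[g | MeasurableSpace.invariants f]) x)) := by
  have hle := MeasurableSpace.invariants_le f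
  set c := μ[g | MeasurableSpace.invariants f]
  have hcm' : Measurable[MeasurableSpace.invariants f] c := stronglyMeasurable_condExp.measurable
  have hcm : Measurable c := hcm'.mono hle le_rfl
  have hc : Integrable c μ := integrable_condExp
  have hinv : c ∘ f = c := MeasurableSpace.comp_eq_of_measurable_invariants hcm'
  have hgc : ∀ s, MeasurableSet s → f ⁻¹' s = s → ∫ x in s, c x ∂μ = ∫ x in s, g x ∂μ :=
    fun s hs hfs => setIntegral_condExp hle hg (by exact ⟨hs, hfs⟩)
  have hinv' : (-c) ∘ f = -c := congrArg Neg.neg hinv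
  -- The bound for `g` controls the limsup, that for `-g` the liminf; `ε = 1/(k+1)` keeps the
  -- exceptional sets countable in number.
  have h1 : ∀ᵐ x ∂μ, ∀ k : ℕ, ∃ N : ℕ, ∀ n,
      birkhoffSum f (fun y => g y - c y - 1 / ((k : ℝ) + 1)) n x ≤ N :=
    ae_all_iff.2 fun k => ae_bddAbove_birkhoffSum hf hgm hg hcm hc
      (fun s hs hfs => (hgc s hs hfs).ge) Nat.one_div_pos_of_nat
  have h2 : ∀ᵐ x ∂μ, ∀ k : ℕ, ∃ N : ℕ, ∀ n,
      birkhoffSum f (fun y => (-g) y - (-c) y - 1 / ((k : ℝ) + 1)) n x ≤ N :=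
    ae_all_iff.2 fun k => ae_bddAbove_birkhoffSum hf hgm.neg hg.neg hcm.neg hc.neg
      (fun s hs hfs => by
        simp only [Pi.neg_apply, integral_neg]
        exact (neg_le_neg (hgc s hs hfs).le)) Nat.one_div_pos_of_nat
  filter_upwards [h1, h2] with x hx1 hx2
  rw [Metric.tendsto_atTop']
  intro ε hε
  obtain ⟨k, hk⟩ := exists_nat_one_div_lt (half_pos hε)
  obtain ⟨N1, hN1⟩ := hx1 k
  obtain ⟨N2, hN2⟩ := hx2 k
  have e1 := eventually_birkhoffAverage_lt hinv Nat.one_div_pos_of_nat hN1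
  have e2 := eventually_birkhoffAverage_lt hinv' Nat.one_div_pos_of_nat hN2
  obtain ⟨N, hN⟩ := eventually_atTop.1 (e1.and e2)
  refine ⟨N, fun n hn => ?_⟩
  obtain ⟨a1, a2⟩ := hN n hn.le
  rw [birkhoffAverage_neg] at a2
  simp only [Pi.neg_apply] at a2
  rw [Real.dist_eq, abs_lt]
  constructor <;> linarith

end Birkhoff

/-! ### Empirical measures and identification of the Method II measure. -/

namespace OrbitMeasure

section Empirical

variable {X : Type*} [MeasurableSpace X]

/-- The empirical measure of the first `n` points of the orbit of `x`. -/
noncomputable def empiricalMeasure (f : X → X) (x : X) (n : ℕ) : Measure X :=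
  (n : ℝ≥0∞)⁻¹ • ∑ j ∈ Finset.range n, Measure.dirac (f^[j] x)

theorem empiricalMeasure_apply (f : X → X) (x : X) (n : ℕ) {A : Set X} (hA : MeasurableSet A) :
    empiricalMeasure f x n A =
      (n : ℝ≥0∞)⁻¹ * ∑ j ∈ Finset.range n, pointMass (f^[j] x) A := by
  simp [empiricalMeasure, pointMass, Measure.dirac_apply' _ hA]
  rfl

/-- The shift matters: at index `0` the measure is `⊤ • 0 = 0`. -/
instance isProbabilityMeasure_empiricalMeasure (f : X → X) (x : X) (n : ℕ) :
    IsProbabilityMeasure (empiricalMeasure f x (n + 1)) := by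
  constructor
  rw [empiricalMeasure_apply _ _ _ .univ]
  simp only [pointMass, Set.indicator_univ, Finset.sum_const, Finset.card_range, nsmul_eq_mul,
    mul_one]
  exact ENNReal.inv_mul_cancel (by simp) (by finiteness)

theorem orbitPremeasure_eq_limsup (f : X → X) (x : X) {A : Set X} (hA : MeasurableSet A) :
    orbitPremeasure f x A = limsup (fun n => empiricalMeasure f x (n + 1) A) atTop := by
  rw [limsup_nat_add (fun n => empiricalMeasure f x n A) 1]
  simp only [empiricalMeasure_apply f x _ hA]
  rfl

theorem integral_empiricalMeasure [TopologicalSpace X] [OpensMeasurableSpace X] (f : X → X) (x : X)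
    (n : ℕ) (g : BoundedContinuousFunction X ℝ) :
    ∫ y, g y ∂empiricalMeasure f x n = birkhoffAverage ℝ f g n x := by
  rw [empiricalMeasure, integral_smul_measure,
    integral_finsetSum_measure fun i _ => g.integrable _]
  have h (y : X) : ∫ z, g z ∂Measure.dirac y = g y :=
    integral_dirac' _ _ g.continuous.stronglyMeasurable
  simp [birkhoffAverage, birkhoffSum, h]

end Empirical

theorem orbitPremeasure_empty {X : Type*} (f : X → X) (x : X) : orbitPremeasure f x ∅ = 0 := by
  simp [orbitPremeasure, upperAverage, pointMass]

theorem orbitPremeasure_mono {X : Type*} (f : X → X) (x : X) {A B : Set X} (h : A ⊆ B) :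
    orbitPremeasure f x A ≤ orbitPremeasure f x B := by
  refine limsup_le_limsup (Eventually.of_forall fun n => ?_)
  refine mul_le_mul_right (Finset.sum_le_sum fun i _ => ?_) _
  exact Set.indicator_le_indicator_of_subset h (fun _ => zero_le) _

variable {X : Type*} [MetricSpace X] [MeasurableSpace X] [BorelSpace X]

theorem le_methodII {τ : Set X → ℝ≥0∞} (hτ : τ ∅ = 0) {ν : Measure X}
    (h : ∀ U, IsOpen U → ν U ≤ τ U) : ν ≤ methodII τ := by
  refine Measure.le_iff.2 fun Y hY => ?_
  rw [methodII_apply τ hτ hY]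
  refine le_iSup₂_of_le 1 one_pos (le_iInf fun I => le_iInf fun hI => le_iInf fun hc => ?_)
  exact (measure_mono hc).trans
    ((measure_iUnion_le I).trans (ENNReal.tsum_le_tsum fun i => h _ (hI i).1))

/-- A compact space has countable open covers by sets of small diameter the sum of whose
`ν`-measures is close to the total mass of `ν`, all but finitely many members being empty. -/
theorem exists_open_cover_tsum_le [CompactSpace X] (ν : Measure X) [IsFiniteMeasure ν]
    {r ε : ℝ≥0∞} (hr : 0 < r) (hε : ε ≠ 0) :
    ∃ W : ℕ → Set X, (∀ i, IsOpen (W i) ∧ Metric.ediam (W i) ≤ r) ∧ (⋃ i, W i) = Set.univ ∧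
      (∀ x, {i | x ∈ W i}.Finite) ∧ ∑' i, ν (W i) ≤ ν Set.univ + ε := by
  rcases isEmpty_or_nonempty X with hX | hX
  · exact ⟨fun _ => ∅, by simp, Subsingleton.elim _ _, fun x => isEmptyElim x, by simp⟩
  obtain ⟨δ, hδ, hδε⟩ := ENNReal.exists_pos_sum_of_countable' hε ℕ
  set d := TopologicalSpace.denseSeq X
  set B : ℕ → Set X := fun i => Metric.eball (d i) (r / 2)
  have hr2 : 0 < r / 2 := ENNReal.half_pos hr.ne'
  have hB : ⋃ i, B i = Set.univ := by
    refine Set.eq_univ_of_forall fun x => ?_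
    obtain ⟨i, hi⟩ := (TopologicalSpace.denseRange_denseSeq X).exists_mem_open
      (Metric.isOpen_eball (x := x) (ε := r / 2)) ⟨x, Metric.mem_eball_self hr2⟩
    exact Set.mem_iUnion.2 ⟨i, Metric.mem_eball_comm.1 hi⟩
  -- The disjointed balls have total mass exactly `ν univ`; outer regularity makes each open at cost
  -- `δ i`, and intersecting with its ball keeps the diameter small.
  have hW0 : ∀ i, ∃ W, disjointed B i ⊆ W ∧ W ⊆ B i ∧ IsOpen W ∧
      ν W ≤ ν (disjointed B i) + δ i := fun i => by
    obtain ⟨U, hU, hUo, hUν⟩ := Set.exists_isOpen_le_add (disjointed B i) ν (hδ i).ne'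
    exact ⟨U ∩ B i, Set.subset_inter hU (disjointed_subset B i), Set.inter_subset_right,
      hUo.inter Metric.isOpen_eball, (measure_mono Set.inter_subset_left).trans hUν⟩
  choose W hW1 hW2 hW3 hW4 using hW0
  have hWc : Set.univ ⊆ ⋃ i, W i := by
    rw [← hB, ← iUnion_disjointed]
    exact Set.iUnion_mono hW1
  obtain ⟨t, ht⟩ := isCompact_univ.elim_finite_subcover W hW3 hWc
  classical
  refine ⟨fun i => if i ∈ t then W i else ∅, fun i => ?_, ?_, fun x => ?_, ?_⟩
  · dsimp only
    split_ifs
    · refine ⟨hW3 i, (Metric.ediam_mono (hW2 i)).trans (Metric.ediam_eball_le.trans ?_)⟩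
      rw [ENNReal.mul_div_cancel (by simp) (by simp)]
    · simp
  · refine Set.eq_univ_of_univ_subset (ht.trans ?_)
    refine Set.iUnion₂_subset fun i hi => ?_
    exact Set.subset_iUnion_of_subset i (by simp [hi])
  · refine t.finite_toSet.subset fun i hi => ?_
    by_contra h
    simp only [Finset.mem_coe] at h
    simp [h] at hi
  · calc ∑' i, ν (if i ∈ t then W i else ∅) ≤ ∑' i, (ν (disjointed B i) + δ i) := by
          refine ENNReal.tsum_le_tsum fun i => ?_
          split_ifs
          · exact hW4 i
          · simp
      _ = ν Set.univ + ∑' i, δ i := by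
          rw [ENNReal.tsum_add, ← measure_iUnion (disjoint_disjointed B)
            (MeasurableSet.disjointed fun i => Metric.isOpen_eball.measurableSet),
            iUnion_disjointed, hB]
      _ ≤ ν Set.univ + ε := by gcongr

theorem methodII_univ_le [CompactSpace X] {τ : Set X → ℝ≥0∞} (hτ : τ ∅ = 0) {ν : Measure X}
    [IsFiniteMeasure ν] (h : ∀ U, IsOpen U → τ U ≤ ν (closure U)) :
    methodII τ Set.univ ≤ ν Set.univ := by
  rw [methodII_apply τ hτ .univ]
  refine iSup₂_le fun r hr => ENNReal.le_of_forall_pos_le_add fun ε hε _ => ?_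
  obtain ⟨W, hW, hWc, hWf, hWν⟩ := exists_open_cover_tsum_le ν hr
    (ε := ε) (by exact_mod_cast hε.ne')
  -- Shrinking the cover so that `closure (V i) ⊆ W i` turns the bound by closures into one by the
  -- masses of the `W i`.
  obtain ⟨V, hVc, hVo, hVW⟩ := exists_iUnion_eq_closure_subset (fun i => (hW i).1) hWf hWc
  refine iInf_le_of_le V (iInf_le_of_le (fun i => ⟨hVo i, ?_⟩) (iInf_le_of_le hVc.ge ?_))
  · exact (Metric.ediam_mono (subset_closure.trans (hVW i))).trans (hW i).2
  · exact (ENNReal.tsum_le_tsum fun i => (h _ (hVo i)).trans (measure_mono (hVW i))).trans hWν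

/-- If the orbit of `x` equidistributes with respect to a probability measure `ν`, then the
Method II measure of the orbit is `ν`. -/
theorem orbitMeasure_eq_of_tendsto_birkhoffAverage [CompactSpace X] {f : X → X} {x : X}
    {ν : Measure X} [IsProbabilityMeasure ν]
    (h : ∀ g : C(X, ℝ), Tendsto (fun n => birkhoffAverage ℝ f g n x) atTop (𝓝 (∫ y, g y ∂ν))) :
    orbitMeasure f x = ν := by
  let e : ℕ → ProbabilityMeasure X := fun n => ⟨empiricalMeasure f x (n + 1), inferInstance⟩
  let ν' : ProbabilityMeasure X := ⟨ν, inferInstance⟩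
  have he : Tendsto e atTop (𝓝 ν') := by
    rw [ProbabilityMeasure.tendsto_iff_forall_integral_tendsto]
    intro g
    have := (tendsto_add_atTop_iff_nat 1).2 (h g.toContinuousMap)
    refine this.congr fun n => ?_
    exact (integral_empiricalMeasure f x (n + 1) g).symm
  have hle : ν ≤ orbitMeasure f x := by
    refine le_methodII (orbitPremeasure_empty f x) fun U hU => ?_
    rw [orbitPremeasure_eq_limsup f x hU.measurableSet]
    exact (ProbabilityMeasure.le_liminf_measure_open_of_tendsto he hU).trans liminf_le_limsup
  -- For finite measures, domination with equal total mass forces equality.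
  refine (Measure.eq_of_le_of_measure_univ_eq hle (le_antisymm (hle _) ?_)).symm
  refine methodII_univ_le (orbitPremeasure_empty f x) fun U _ => ?_
  refine (orbitPremeasure_mono f x subset_closure).trans ?_
  rw [orbitPremeasure_eq_limsup f x isClosed_closure.measurableSet]
  exact ProbabilityMeasure.limsup_measure_closed_le_of_tendsto he isClosed_closure

end OrbitMeasure

/-! ### Reduction to dense families of observables; an ergodicity criterion. -/

namespace OrbitMeasure

section ContinuousMap

variable {X : Type*} [TopologicalSpace X] [CompactSpace X]

theorem dist_birkhoffAverage_le (f : X → X) (g h : C(X, ℝ)) (n : ℕ) (x : X) :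
    dist (birkhoffAverage ℝ f g n x) (birkhoffAverage ℝ f h n x) ≤ dist g h := by
  rcases n.eq_zero_or_pos with rfl | hn
  · simp
  have hn' : (0 : ℝ) < n := by exact_mod_cast hn
  simp only [birkhoffAverage, smul_eq_mul, Real.dist_eq, ← mul_sub, abs_mul, abs_inv,
    Nat.abs_cast, birkhoffSum, ← Finset.sum_sub_distrib]
  rw [inv_mul_le_iff₀ hn']
  calc |∑ k ∈ Finset.range n, (g (f^[k] x) - h (f^[k] x))|
      ≤ ∑ k ∈ Finset.range n, |g (f^[k] x) - h (f^[k] x)| := Finset.abs_sum_le_sum_abs _ _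
    _ ≤ ∑ _k ∈ Finset.range n, dist g h :=
      Finset.sum_le_sum fun k _ => ContinuousMap.dist_apply_le_dist (f := g) (g := h) _
    _ = n * dist g h := by simp

variable [MeasurableSpace X] [BorelSpace X]

theorem integrable_continuousMap (ν : Measure X) [IsFiniteMeasure ν] (g : C(X, ℝ)) :
    Integrable g ν :=
  (BoundedContinuousFunction.mkOfCompact g).integrable ν

theorem continuous_integral_continuousMap (ν : Measure X) [IsFiniteMeasure ν] :
    Continuous fun g : C(X, ℝ) => ∫ y, g y ∂ν := by
  refine (LipschitzWith.of_dist_le_mul (K := (ν Set.univ).toNNReal) fun g h => ?_).continuous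
  rw [Real.dist_eq, ← integral_sub (integrable_continuousMap ν g) (integrable_continuousMap ν h),
    mul_comm]
  refine norm_integral_le_of_norm_le_const (μ := ν) (f := fun y => g y - h y)
    (Eventually.of_forall fun y => ?_)
  exact ContinuousMap.dist_apply_le_dist (f := g) (g := h) y

theorem tendsto_birkhoffAverage_of_dense {f : X → X} {x : X} {ν : Measure X} [IsFiniteMeasure ν]
    {s : Set C(X, ℝ)} (hs : Dense s)
    (h : ∀ g ∈ s, Tendsto (fun n => birkhoffAverage ℝ f g n x) atTop (𝓝 (∫ y, g y ∂ν)))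
    (g : C(X, ℝ)) : Tendsto (fun n => birkhoffAverage ℝ f g n x) atTop (𝓝 (∫ y, g y ∂ν)) := by
  rw [Metric.tendsto_atTop]
  intro ε hε
  have hε3 : 0 < ε / 3 := by positivity
  obtain ⟨k, hk, hks⟩ := hs.exists_mem_open
    (((continuous_integral_continuousMap ν).isOpen_preimage _ Metric.isOpen_ball).inter
      Metric.isOpen_ball)
    ⟨g, Metric.mem_ball_self hε3, Metric.mem_ball_self hε3⟩
  obtain ⟨N, hN⟩ := Metric.tendsto_atTop.1 (h k hk) (ε / 3) hε3
  refine ⟨N, fun n hn => ?_⟩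
  have h1 := dist_birkhoffAverage_le f k g n x
  have h2 := hN n hn
  have h3 : dist (∫ y, k y ∂ν) (∫ y, g y ∂ν) < ε / 3 := hks.1
  have h4 : dist k g < ε / 3 := hks.2
  rw [dist_comm] at h1
  have h5 := dist_triangle4 (birkhoffAverage ℝ f g n x) (birkhoffAverage ℝ f k n x)
    (∫ y, k y ∂ν) (∫ y, g y ∂ν)
  linarith

theorem measure_ext_of_dense [HasOuterApproxClosed X] {ν ρ : Measure X} [IsFiniteMeasure ν]
    [IsFiniteMeasure ρ] {s : Set C(X, ℝ)} (hs : Dense s)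
    (h : ∀ g ∈ s, ∫ y, g y ∂ν = ∫ y, g y ∂ρ) : ν = ρ := by
  have := (continuous_integral_continuousMap ν).ext_on hs (continuous_integral_continuousMap ρ) h
  exact ext_of_forall_integral_eq_of_IsFiniteMeasure fun g => congrFun this g.toContinuousMap

/-- An invariant probability measure with respect to which almost every point equidistributes is
ergodic. -/
theorem ergodic_of_ae_tendsto_birkhoffAverage [HasOuterApproxClosed X] {f : X → X} {ν : Measure X}
    [IsProbabilityMeasure ν] (hf : MeasurePreserving f ν ν) {s : Set C(X, ℝ)} (hs : Dense s)
    (h : ∀ g ∈ s, ∀ᵐ y ∂ν,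
      Tendsto (fun n => birkhoffAverage ℝ f g n y) atTop (𝓝 (∫ z, g z ∂ν))) :
    Ergodic f ν := by
  refine ⟨hf, ⟨fun B hB hfB => ?_⟩⟩
  have hres : MeasurePreserving f (ν.restrict B) (ν.restrict B) := by
    have := hf.restrict_preimage hB
    rwa [hfB] at this
  -- Averaging preserves `∫_B g` by invariance of `B`, while the averages converge boundedly to the
  -- constant `∫ g dν`. Evaluating at `B` then gives `ν B = (ν B)²`.
  have key : ν.restrict B = ν B • ν := by
    have : IsFiniteMeasure (ν B • ν) := Measure.smul_finite ν (measure_ne_top _ _)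
    refine measure_ext_of_dense hs fun g hg => ?_
    have hgi := integrable_continuousMap (ν.restrict B) g
    have hit : ∀ k, ∫ y, g (f^[k] y) ∂ν.restrict B = ∫ y, g y ∂ν.restrict B := fun k => by
      have hk := hres.iterate k
      conv_rhs => rw [← hk.map_eq]
      exact (integral_map hk.aemeasurable (g.continuous.measurable.aestronglyMeasurable)).symm
    have hint : ∀ k, Integrable (fun y => g (f^[k] y)) (ν.restrict B) := fun k =>
      (hres.iterate k).integrable_comp_of_integrable hgi
    have hn : ∀ n : ℕ, ∫ y, birkhoffAverage ℝ f g (n + 1) y ∂ν.restrict B =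
        ∫ y, g y ∂ν.restrict B := fun n => by
      have : ((n + 1 : ℕ) : ℝ) ≠ 0 := by positivity
      simp only [birkhoffAverage, birkhoffSum, smul_eq_mul]
      rw [integral_const_mul, integral_finsetSum _ fun k _ => hint k]
      simp only [hit, Finset.sum_const, Finset.card_range, nsmul_eq_mul]
      field_simp
    have hlim : Tendsto (fun n : ℕ => ∫ y, birkhoffAverage ℝ f g (n + 1) y ∂ν.restrict B) atTop
        (𝓝 (∫ _, (∫ z, g z ∂ν) ∂ν.restrict B)) := by
      refine tendsto_integral_of_dominated_convergence (fun _ => ‖g‖) (fun n => ?_)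
        (integrable_const _) (fun n => Eventually.of_forall fun y => ?_) ?_
      · exact ((measurable_birkhoffSum hf.measurable g.continuous.measurable
          (n + 1)).const_smul ((n + 1 : ℕ) : ℝ)⁻¹).aestronglyMeasurable
      · have := dist_birkhoffAverage_le f g 0 (n + 1) y
        have h0 : birkhoffAverage ℝ f (0 : C(X, ℝ)) (n + 1) y = 0 := by
          simp [birkhoffAverage, birkhoffSum]
        rwa [h0, dist_zero_right, dist_zero_right] at this
      · filter_upwards [ae_restrict_of_ae (h g hg)] with y hy
        exact (tendsto_add_atTop_iff_nat 1).2 hy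
    simp only [hn] at hlim
    rw [tendsto_nhds_unique tendsto_const_nhds hlim, integral_smul_measure]
    simp [measureReal_def]
  have hB2 : ν B = ν B * ν B := by
    have := congrArg (fun ρ : Measure X => ρ B) key
    simpa using this
  rw [eventuallyConst_set']
  rcases eq_or_ne (ν B) 0 with h0 | h0
  · exact .inl (ae_eq_empty.2 h0)
  · refine .inr (eventuallyEq_univ.2 ?_)
    have h1 : ν B = 1 := by
      have := (ENNReal.mul_eq_left h0 (measure_ne_top ν B)).1 hB2.symm
      exact this
    exact (prob_compl_eq_zero_iff hB).2 h1

end ContinuousMap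

/-! ### Ergodic decomposition through conditional measures. -/

section Decomposition

open ProbabilityTheory

variable {Ω : Type*} {m : MeasurableSpace Ω} [mΩ : MeasurableSpace Ω] [StandardBorelSpace Ω] {μ : Measure Ω}
  [IsFiniteMeasure μ]

/-- A bounded function measurable with respect to `m` is almost surely constant for almost every
conditional measure. -/
theorem ae_ae_condExpKernel_eq (hm : m ≤ mΩ) {c : Ω → ℝ}
    (hc : StronglyMeasurable[m] c) {C : ℝ} (hC : ∀ y, |c y| ≤ C) :
    ∀ᵐ x ∂μ, ∀ᵐ y ∂condExpKernel μ m x, c y = c x := by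
  have hcΩ : StronglyMeasurable c := hc.mono hm
  have hb (ν : Measure Ω) [IsFiniteMeasure ν] : Integrable c ν :=
    .of_bound hcΩ.aestronglyMeasurable C (Eventually.of_forall hC)
  have hb2 (ν : Measure Ω) [IsFiniteMeasure ν] : Integrable (fun y => c y ^ 2) ν := by
    refine .of_bound (hcΩ.pow 2).aestronglyMeasurable (C ^ 2) (Eventually.of_forall fun y => ?_)
    rw [norm_pow]
    exact pow_le_pow_left₀ (norm_nonneg _) (hC y) 2
  have h1 := condExp_ae_eq_integral_condExpKernel hm (hb μ)
  have h2 := condExp_ae_eq_integral_condExpKernel hm (hb2 μ)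
  rw [condExp_of_stronglyMeasurable hm hc (hb μ)] at h1
  rw [condExp_of_stronglyMeasurable hm (f := fun y => c y ^ 2) (hc.pow 2) (hb2 μ)] at h2
  filter_upwards [h1, h2] with x hx1 hx2
  set κ := condExpKernel μ m x
  -- The conditional variance vanishes, as both `c` and `c ^ 2` are their own conditional
  -- expectations.
  have hsq : ∫ y, (c y - c x) ^ 2 ∂κ = 0 := by
    have : ∀ y, (c y - c x) ^ 2 = c y ^ 2 - 2 * c x * c y + c x ^ 2 := fun y => by ring
    simp only [this]
    rw [integral_add (f := fun y => c y ^ 2 - 2 * c x * c y)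
        ((hb2 κ).sub ((hb κ).const_mul _)) (integrable_const _),
      integral_sub (hb2 κ) ((hb κ).const_mul _), integral_const_mul, ← hx1, ← hx2]
    simp
    ring
  have hi : Integrable (fun y => (c y - c x) ^ 2) κ := by
    have : ∀ y, (c y - c x) ^ 2 = c y ^ 2 - 2 * c x * c y + c x ^ 2 := fun y => by ring
    simp only [this]
    exact ((hb2 κ).sub ((hb κ).const_mul _)).add (integrable_const _)
  filter_upwards [(integral_eq_zero_iff_of_nonneg (fun y => sq_nonneg _) hi).1 hsq] with y hy
  exact sub_eq_zero.1 (pow_eq_zero_iff two_ne_zero |>.1 hy)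

theorem ae_ae_condExpKernel_of_ae (hm : m ≤ mΩ) {p : Ω → Prop}
    (h : ∀ᵐ x ∂μ, p x) : ∀ᵐ x ∂μ, ∀ᵐ y ∂condExpKernel μ m x, p y := by
  refine ae_of_ae_trim hm (Measure.ae_ae_of_ae_comp ?_)
  rwa [condExpKernel_comp_trim hm]

theorem lintegral_condExpKernel_apply (hm : m ≤ mΩ) {V : Set Ω}
    (hV : MeasurableSet V) : ∫⁻ x, condExpKernel μ m x V ∂μ = μ V := by
  conv_rhs => rw [← condExpKernel_comp_trim (μ := μ) hm]
  rw [Measure.bind_apply hV (Kernel.aemeasurable _), lintegral_trim hm (measurable_condExpKernel hV)]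

theorem integral_integral_condExpKernel (hm : m ≤ mΩ) {φ : Ω → ℝ}
    (hφ : Integrable φ μ) : ∫ x, ∫ y, φ y ∂condExpKernel μ m x ∂μ = ∫ x, φ x ∂μ := by
  rw [← integral_condExp hm (f := φ)]
  exact integral_congr_ae (condExp_ae_eq_integral_condExpKernel hm hφ).symm

theorem ae_tendsto_birkhoffAverage_condExpKernel {f : Ω → Ω} (hf : MeasurePreserving f μ μ)
    {g : Ω → ℝ} (hgm : Measurable g) (hg : Integrable g μ) :
    ∀ᵐ x ∂μ, Tendsto (fun n => birkhoffAverage ℝ f g n x) atTop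
      (𝓝 (∫ y, g y ∂condExpKernel μ (MeasurableSpace.invariants f) x)) := by
  filter_upwards [ae_tendsto_birkhoffAverage_condExp hf hgm hg,
    condExp_ae_eq_integral_condExpKernel (MeasurableSpace.invariants_le f) hg] with x h1 h2
  rwa [h2] at h1

/-- The averages of `g ∘ f` and `g` along an orbit differ by a telescoping term of order `1/n`, so
their limits agree. -/
theorem ae_integral_comp_condExpKernel_eq {f : Ω → Ω} (hf : MeasurePreserving f μ μ)
    {g : Ω → ℝ} (hgm : Measurable g) {C : ℝ} (hC : ∀ y, |g y| ≤ C) :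
    ∀ᵐ x ∂μ, ∫ y, g (f y) ∂condExpKernel μ (MeasurableSpace.invariants f) x =
      ∫ y, g y ∂condExpKernel μ (MeasurableSpace.invariants f) x := by
  have hg : Integrable g μ := .of_bound hgm.aestronglyMeasurable C (Eventually.of_forall hC)
  filter_upwards [ae_tendsto_birkhoffAverage_condExpKernel hf hgm hg,
    ae_tendsto_birkhoffAverage_condExpKernel hf (hgm.comp hf.measurable)
      (hf.integrable_comp_of_integrable hg)] with x h1 h2
  have hb : Bornology.IsBounded (Set.range g) := by
    refine (Metric.isBounded_Icc (-C) C).subset ?_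
    rintro _ ⟨y, rfl⟩
    exact abs_le.1 (hC y)
  have h3 := (tendsto_birkhoffAverage_apply_sub_birkhoffAverage' ℝ hb f x).add h1
  rw [zero_add] at h3
  refine tendsto_nhds_unique h2 (h3.congr fun n => ?_)
  rw [sub_add_cancel]
  simp [birkhoffAverage, birkhoffSum, ← Function.iterate_succ_apply, Function.iterate_succ_apply']

variable {X : Type*} [MetricSpace X] [CompactSpace X] [MeasurableSpace X] [BorelSpace X]
  {f : X → X} {ρ : Measure X} [IsFiniteMeasure ρ]

/-- The conditional measures of an invariant measure with respect to the σ-algebra of invariant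
sets are ergodic, and almost every orbit equidistributes with respect to its conditional
measure. -/
theorem ae_condExpKernel_invariants (hf : MeasurePreserving f ρ ρ) :
    ∀ᵐ x ∂ρ, Ergodic f (condExpKernel ρ (MeasurableSpace.invariants f) x) ∧
      orbitMeasure f x = condExpKernel ρ (MeasurableSpace.invariants f) x := by
  have hle := MeasurableSpace.invariants_le f
  set κ := condExpKernel ρ (MeasurableSpace.invariants f)
  obtain ⟨s, hsc, hs⟩ := TopologicalSpace.exists_countable_dense C(X, ℝ)
  have hnorm (g : C(X, ℝ)) (y : X) : |g y| ≤ ‖g‖ := g.norm_coe_le_norm y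
  have h1 : ∀ᵐ x ∂ρ, ∀ g ∈ s,
      Tendsto (fun n => birkhoffAverage ℝ f g n x) atTop (𝓝 (∫ y, g y ∂κ x)) :=
    (ae_ball_iff hsc).2 fun g _ => ae_tendsto_birkhoffAverage_condExpKernel hf
      g.continuous.measurable (integrable_continuousMap ρ g)
  have h2 : ∀ᵐ x ∂ρ, ∀ g ∈ s, ∫ y, g (f y) ∂κ x = ∫ y, g y ∂κ x :=
    (ae_ball_iff hsc).2 fun g _ =>
      ae_integral_comp_condExpKernel_eq hf g.continuous.measurable (hnorm g)
  have h3 : ∀ᵐ x ∂ρ, ∀ g ∈ s, ∀ᵐ y ∂κ x, ∫ z, g z ∂κ y = ∫ z, g z ∂κ x := by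
    refine (ae_ball_iff hsc).2 fun g _ => ae_ae_condExpKernel_eq hle (C := ‖g‖)
      (g.continuous.measurable.stronglyMeasurable.integral_condExpKernel) fun y => ?_
    simpa using norm_integral_le_of_norm_le_const (μ := κ y) (f := g)
      (Eventually.of_forall (hnorm g))
  -- `h4` says that `κ x`-almost every `y` equidistributes towards `κ y`; `h3` replaces its
  -- integrals by those of `κ x`.
  filter_upwards [h1, h2, h3, ae_ae_condExpKernel_of_ae hle h1] with x h1 h2 h3 h4
  have hfx : MeasurePreserving f (κ x) (κ x) := by
    refine ⟨hf.measurable, ?_⟩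
    have := Measure.isProbabilityMeasure_map (μ := κ x) hf.measurable.aemeasurable
    refine measure_ext_of_dense hs fun g hg => ?_
    rw [integral_map hf.measurable.aemeasurable g.continuous.measurable.aestronglyMeasurable,
      h2 g hg]
  refine ⟨ergodic_of_ae_tendsto_birkhoffAverage hfx hs fun g hg => ?_,
    orbitMeasure_eq_of_tendsto_birkhoffAverage (tendsto_birkhoffAverage_of_dense hs h1)⟩
  filter_upwards [h4, h3 g hg] with y hy1 hy2
  have := hy1 g hg
  rwa [hy2] at this

end Decomposition

end OrbitMeasure

theorem theoremA {X : Type*} [MetricSpace X] [CompactSpace X] [PerfectSpace X]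
    [MeasurableSpace X] [BorelSpace X] (f : X → X) (hf : Measurable f)
    (μ : MeasureTheory.Measure X) [MeasureTheory.IsFiniteMeasure μ]
    (hμ : MeasureTheory.MeasurePreserving f μ μ) :
    (∀ᵐ x ∂μ, MeasureTheory.IsProbabilityMeasure (OrbitMeasure.orbitMeasure f x) ∧
      Ergodic f (OrbitMeasure.orbitMeasure f x)) ∧
    (∀ V : Set X, MeasurableSet V →
      AEMeasurable (fun x => OrbitMeasure.orbitMeasure f x V) μ ∧
      μ V = ∫⁻ x, OrbitMeasure.orbitMeasure f x V ∂μ) ∧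
    (∀ φ : X → ℝ, MeasureTheory.Integrable φ μ →
      (∀ᵐ x ∂μ, MeasureTheory.Integrable φ (OrbitMeasure.orbitMeasure f x)) ∧
      MeasureTheory.Integrable (fun x => ∫ y, φ y ∂(OrbitMeasure.orbitMeasure f x)) μ ∧
      ∫ x, φ x ∂μ = ∫ x, (∫ y, φ y ∂(OrbitMeasure.orbitMeasure f x)) ∂μ) := by
  have hle := MeasurableSpace.invariants_le f
  have h := OrbitMeasure.ae_condExpKernel_invariants hμ
  have heq := h.mono fun _ hx => hx.2
  refine ⟨?_, fun V hV => ⟨?_, ?_⟩, fun φ hφ => ⟨?_, ?_, ?_⟩⟩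
  · filter_upwards [h] with x ⟨h1, h2⟩
    rw [h2]
    have hκ : ProbabilityTheory.IsMarkovKernel
        (ProbabilityTheory.condExpKernel μ (MeasurableSpace.invariants f)) := inferInstance
    exact ⟨hκ.isProbabilityMeasure x, h1⟩
  -- The conditional kernel serves as the measurable version of `x ↦ η_x V`.
  · refine ⟨_, (ProbabilityTheory.measurable_condExpKernel (μ := μ) hV).mono hle le_rfl, ?_⟩
    filter_upwards [heq] with x hx
    rw [hx]
  · rw [← OrbitMeasure.lintegral_condExpKernel_apply hle hV]
    refine lintegral_congr_ae ?_
    filter_upwards [heq] with x hx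
    rw [hx]
  · filter_upwards [heq, hφ.condExpKernel_ae (m := MeasurableSpace.invariants f)] with x hx hx'
    rwa [hx]
  · refine (hφ.integral_condExpKernel (m := MeasurableSpace.invariants f)).congr ?_
    filter_upwards [heq] with x hx
    rw [hx]
  · rw [← OrbitMeasure.integral_integral_condExpKernel hle hφ]
    refine integral_congr_ae ?_
    filter_upwards [heq] with x hx
    rw [hx]
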